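/- Let $N\ge 1$. Define differential polynomials $L_k[u]$ by $L_0[u]=\tfrac12$ and the Lenard recursion $$\frac{d}{dz}L_{k+1}[u]=\Big(\frac{d^3}{dz^3}+4u\frac{d}{dz}+2u_z\Big)L_k[u],\qquad k\ge 0,$$ where every $L_{k}[u]$ with $k\ge1$ is taken without constant term. The $N$-th equation of the second Painlevé hierarchy with parameter $\alpha$ is $$P_2^{(N)}[w,\alpha]=\Big(\frac{d}{dz}+2w\Big)L_N[w'-w^2]-zw-\alpha=0 .$$ For $\alpha\in\mathbb C$ let $$w(z;\alpha)=\sum_{m=0}^{\infty}c_{\alpha,-(m+1)}\,z^{-m-1}$$ be the expansion at infinity of its (unique) formal solution of this form. Let $Q_0=1$, and let $Q_1,Q_2,\dots$ be the monic complex polynomials such that for every $i\ge 1$ the rational function $$w=\frac{d}{dz}\ln\frac{Q_{i-1}(z)}{Q_i(z)}$$ is a solution of $P_2^{(N)}[w,i]=0$. Let $p_n$ be the degree of $Q_n$, let $a_{n,1},\dots,a_{n,p_n}$ be its complex roots, listed with multiplicity, and let $s_{n,m}=\sum_{k=1}^{p_n}a_{n,k}^m$. Then for each $n\ge 2$ $$s_{n,m}=-\sum_{i=2}^{n}c_{i,-(m+1)}\quad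 (m\ge 1),\qquad\text{and}\qquad p_n=-\sum_{i=1}^{n}c_{i,-1}.$$ -/

import Mathlib

open Polynomial

noncomputable section

namespace PIIHierarchy

/-! ### Differential polynomials and the Lenard recursion -/

/-- Differential polynomials in one unknown `u`; the variable `X j` stands for the `j`-th
derivative of `u`. -/
abbrev DiffPoly : Type := MvPolynomial ℕ ℂ

/-- The total derivative on differential polynomials: the derivation with `u^(j) ↦ u^(j+1)`. -/
def totalDeriv : Derivation ℂ DiffPoly DiffPoly :=
  MvPolynomial.mkDerivation ℂ (fun j => MvPolynomial.X (j + 1))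

/-- The Lenard sequence `L_0 = 1/2`, `d L_{N+1} = (d^3 + 4 u d + 2 u_z) L_N`. The recursion fixes
each `L_{N+1}` up to an additive constant, and the constant term is taken to be zero. -/
structure IsLenardSequence (L : ℕ → DiffPoly) : Prop where
  zero : L 0 = MvPolynomial.C (1 / 2)
  succ : ∀ N, totalDeriv (L (N + 1)) =
    totalDeriv (totalDeriv (totalDeriv (L N))) + 4 * MvPolynomial.X 0 * totalDeriv (L N)
      + 2 * MvPolynomial.X 1 * L N
  constantCoeff : ∀ N, MvPolynomial.constantCoeff (L (N + 1)) = 0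

/-- An auxiliary explicit sequence, used only to show that the Lenard sequence exists. -/
def lenardAux : ℕ → DiffPoly
  | 0 => MvPolynomial.C (1 / 2)
  | n + 1 =>
    (∑ j : Fin (n + 1),
      (2 * lenardAux j * totalDeriv (totalDeriv (lenardAux (n - j)))
        - totalDeriv (lenardAux j) * totalDeriv (lenardAux (n - j))
        + 4 * MvPolynomial.X 0 * (lenardAux j * lenardAux (n - j))))
    - ∑ k : Fin n, lenardAux (k + 1) * lenardAux (n - k)
termination_by n => n
decreasing_by all_goals omega

theorem constantCoeff_totalDeriv (P : DiffPoly) :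
    MvPolynomial.constantCoeff (totalDeriv P) = 0 := by
  induction P using MvPolynomial.induction_on with
  | C a => simp [totalDeriv]
  | add p q hp hq => simp [hp, hq]
  | mul_X p n hp => simp [Derivation.leibniz, totalDeriv]

theorem constantCoeff_lenardAux (N : ℕ) :
    MvPolynomial.constantCoeff (lenardAux (N + 1)) = 0 := by
  induction N using Nat.strong_induction_on with
  | _ n ih =>
    rw [lenardAux]
    have h : ∀ k : Fin n, MvPolynomial.constantCoeff (lenardAux (k + 1)) = 0 :=
      fun k => ih k k.2
    simp [constantCoeff_totalDeriv, h]

/-- The total derivative applied to every coefficient of a power series. -/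
def coeffDeriv (f : PowerSeries DiffPoly) : PowerSeries DiffPoly :=
  PowerSeries.mk fun n => totalDeriv (PowerSeries.coeff n f)

theorem coeffDeriv_add (f g : PowerSeries DiffPoly) :
    coeffDeriv (f + g) = coeffDeriv f + coeffDeriv g := by
  ext1 n; simp [coeffDeriv]

theorem coeffDeriv_sub (f g : PowerSeries DiffPoly) :
    coeffDeriv (f - g) = coeffDeriv f - coeffDeriv g := by
  ext1 n; simp [coeffDeriv]

theorem coeffDeriv_mul (f g : PowerSeries DiffPoly) :
    coeffDeriv (f * g) = f * coeffDeriv g + g * coeffDeriv f := by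
  rw [mul_comm g]
  ext1 n
  simp only [coeffDeriv, PowerSeries.coeff_mk, PowerSeries.coeff_mul, map_sum, map_add,
    Derivation.leibniz, Finset.sum_add_distrib, smul_eq_mul]
  congr 1
  exact Finset.sum_congr rfl fun x _ => mul_comm _ _

theorem coeffDeriv_C (a : DiffPoly) :
    coeffDeriv (PowerSeries.C a) = PowerSeries.C (totalDeriv a) := by
  ext1 n
  simp only [coeffDeriv, PowerSeries.coeff_mk, PowerSeries.coeff_C]
  split_ifs <;> simp

theorem coeffDeriv_X : coeffDeriv (PowerSeries.X : PowerSeries DiffPoly) = 0 := by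
  ext1 n
  simp only [coeffDeriv, PowerSeries.coeff_mk, PowerSeries.coeff_X]
  split_ifs <;> simp

theorem isLenardSequence_lenardAux : IsLenardSequence lenardAux := by
  refine ⟨by rw [lenardAux], ?_, constantCoeff_lenardAux⟩
  set G : PowerSeries DiffPoly := PowerSeries.mk lenardAux with hG
  set u : PowerSeries DiffPoly := PowerSeries.C (MvPolynomial.X 0) with hu
  have h0 : lenardAux 0 = MvPolynomial.C (1 / 2) := by rw [lenardAux]
  have key : G * G - PowerSeries.X * (2 * G * coeffDeriv (coeffDeriv G)
      - coeffDeriv G * coeffDeriv G + 4 * u * (G * G))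
      = PowerSeries.C (MvPolynomial.C (1 / 4)) := by
    ext1 n
    cases n with
    | zero =>
      simp only [map_sub, PowerSeries.coeff_zero_eq_constantCoeff, map_mul,
        PowerSeries.constantCoeff_X, zero_mul, sub_zero, PowerSeries.constantCoeff_C]
      rw [← PowerSeries.coeff_zero_eq_constantCoeff_apply, hG, PowerSeries.coeff_mk, h0,
        ← MvPolynomial.C_mul]
      norm_num
    | succ n =>
      have hc : ∀ f : PowerSeries DiffPoly, 2 * G * f = PowerSeries.C 2 * (G * f) := by
        intro f; rw [mul_assoc]; congr 1
      have hc4 : 4 * u * (G * G) = PowerSeries.C (4 * MvPolynomial.X 0) * (G * G) := by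
        rw [hu, map_mul]; congr 1
      rw [map_sub, PowerSeries.coeff_succ_X_mul, map_add, map_sub, hc, hc4,
        PowerSeries.coeff_C_mul, PowerSeries.coeff_C_mul, PowerSeries.coeff_C,
        if_neg (Nat.succ_ne_zero n)]
      simp only [PowerSeries.coeff_mul, hG, coeffDeriv, PowerSeries.coeff_mk]
      simp only [Finset.Nat.sum_antidiagonal_eq_sum_range_succ_mk]
      rw [Finset.sum_range_succ, Finset.sum_range_succ']
      have e : lenardAux (n + 1) = (∑ j ∈ Finset.range (n + 1),
          (2 * lenardAux j * totalDeriv (totalDeriv (lenardAux (n - j)))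
            - totalDeriv (lenardAux j) * totalDeriv (lenardAux (n - j))
            + 4 * MvPolynomial.X 0 * (lenardAux j * lenardAux (n - j))))
          - ∑ k ∈ Finset.range n, lenardAux (k + 1) * lenardAux (n - k) := by
        rw [lenardAux, Finset.sum_range, Finset.sum_range]
      have e2 : ∑ k ∈ Finset.range n, lenardAux (k + 1) * lenardAux (n + 1 - (k + 1))
          = ∑ k ∈ Finset.range n, lenardAux (k + 1) * lenardAux (n - k) :=
        Finset.sum_congr rfl fun k _ => by rw [Nat.add_sub_add_right]
      have half : (MvPolynomial.C (1 / 2) : DiffPoly) + MvPolynomial.C (1 / 2) = 1 := by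
        rw [← MvPolynomial.C_add]; norm_num
      rw [e2, Nat.sub_self, Nat.sub_zero, h0]
      have e3 := e
      rw [Finset.sum_add_distrib, Finset.sum_sub_distrib, ← Finset.mul_sum] at e3
      simp only [mul_assoc, ← Finset.mul_sum] at e3 ⊢
      linear_combination (lenardAux (n + 1)) * half + e3
  have hd := congrArg coeffDeriv key
  have c2 : coeffDeriv (2 : PowerSeries DiffPoly) = 0 := by
    rw [show (2 : PowerSeries DiffPoly) = PowerSeries.C (MvPolynomial.C 2) from rfl, coeffDeriv_C]
    simp
  have c4 : coeffDeriv (4 : PowerSeries DiffPoly) = 0 := by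
    rw [show (4 : PowerSeries DiffPoly) = PowerSeries.C (MvPolynomial.C 4) from rfl, coeffDeriv_C]
    simp
  have cr : coeffDeriv (PowerSeries.C (MvPolynomial.C (1 / 4)) : PowerSeries DiffPoly) = 0 := by
    rw [coeffDeriv_C]; simp
  rw [cr] at hd
  simp only [coeffDeriv_add, coeffDeriv_sub, coeffDeriv_mul, coeffDeriv_X, c2, c4] at hd
  have hG0 : G ≠ 0 := by
    intro h
    have := congrArg (PowerSeries.coeff 0) h
    rw [hG, PowerSeries.coeff_mk, h0] at this
    simp at this
  have hfac : (2 * G) * (coeffDeriv G - PowerSeries.X * (coeffDeriv (coeffDeriv (coeffDeriv G))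
      + 4 * u * coeffDeriv G + 2 * coeffDeriv u * G)) = 0 := by
    linear_combination hd
  have h2 : (2 : PowerSeries DiffPoly) ≠ 0 := by
    intro h
    have := congrArg (PowerSeries.coeff 0) h
    rw [show (2 : PowerSeries DiffPoly) = PowerSeries.C 2 from rfl, PowerSeries.coeff_C] at this
    simp at this
  have hlen := (mul_eq_zero.mp hfac).resolve_left (mul_ne_zero h2 hG0)
  intro N
  have hN := congrArg (PowerSeries.coeff (N + 1)) hlen
  rw [map_sub, PowerSeries.coeff_succ_X_mul, hu, coeffDeriv_C,
    show (4 : PowerSeries DiffPoly) = PowerSeries.C 4 from rfl,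
    show (2 : PowerSeries DiffPoly) = PowerSeries.C 2 from rfl, ← map_mul, ← map_mul,
    map_add, map_add, PowerSeries.coeff_C_mul, PowerSeries.coeff_C_mul, map_zero] at hN
  have hX : totalDeriv (MvPolynomial.X 0) = MvPolynomial.X 1 := by simp [totalDeriv]
  simp only [hG, coeffDeriv, PowerSeries.coeff_mk, hX] at hN
  exact sub_eq_zero.mp hN

theorem exists_isLenardSequence : ∃ L, IsLenardSequence L := ⟨_, isLenardSequence_lenardAux⟩

/-- The Lenard differential polynomial `L_N[u]`. -/
def lenard : ℕ → DiffPoly := exists_isLenardSequence.choose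

theorem isLenardSequence_lenard : IsLenardSequence lenard := exists_isLenardSequence.choose_spec

/-! ### The hierarchy -/

/-- The left-hand side `(d + 2 w) L_N[w' - w^2] - z w - α` of the `N`-th equation, in a commutative
algebra `A` whose elements are differentiated (with respect to `z`) by `d`. -/
def painleveTwo {A : Type*} [CommRing A] [Algebra ℂ A] (d : A → A) (z : A) (N : ℕ) (α : ℂ)
    (w : A) : A :=
  let ℓ : A := MvPolynomial.aeval (fun j : ℕ => d^[j] (d w - w ^ 2)) (lenard N)
  d ℓ + 2 * w * ℓ - z * w - algebraMap ℂ A α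

/-! ### Rational solutions and their polynomials -/

/-- The derivative of a rational function, by the quotient rule. -/
def ratDeriv (f : RatFunc ℂ) : RatFunc ℂ :=
  (algebraMap ℂ[X] (RatFunc ℂ) (derivative f.num) * algebraMap ℂ[X] (RatFunc ℂ) f.denom
    - algebraMap ℂ[X] (RatFunc ℂ) f.num * algebraMap ℂ[X] (RatFunc ℂ) (derivative f.denom))
    / algebraMap ℂ[X] (RatFunc ℂ) f.denom ^ 2

/-- The logarithmic derivative of `P / Q`, that is `f' / f` for the rational function
`f = P / Q`. -/
def logDerivQuot (P Q : ℂ[X]) : RatFunc ℂ :=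
  ratDeriv (algebraMap ℂ[X] (RatFunc ℂ) P / algebraMap ℂ[X] (RatFunc ℂ) Q)
    / (algebraMap ℂ[X] (RatFunc ℂ) P / algebraMap ℂ[X] (RatFunc ℂ) Q)

/-- `IsYablonskiiVorobev N n Q`: the polynomial `Q` is the `n`-th Yablonskii--Vorob'ev polynomial
of the `N`-th equation. The first one is `Q_0 = 1`, and `Q_{n+1}` is monic and such that
`w = d/dz log (Q_n / Q_{n+1})` solves the `N`-th equation with parameter `α = n + 1`. -/
inductive IsYablonskiiVorobev (N : ℕ) : ℕ → ℂ[X] → Prop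
  | zero : IsYablonskiiVorobev N 0 1
  | succ {n : ℕ} {P Q : ℂ[X]} (hP : IsYablonskiiVorobev N n P) (hQ : Q.Monic)
      (hw : painleveTwo ratDeriv RatFunc.X N (n + 1 : ℂ) (logDerivQuot P Q) = 0) :
      IsYablonskiiVorobev N (n + 1) Q

/-- The sum of the `m`-th powers of the complex roots of `Q`, with multiplicity. -/
def rootPowerSum (Q : ℂ[X]) (m : ℕ) : ℂ := (Q.roots.map fun a => a ^ m).sum

/-! ### The expansion at infinity

Formal series at `z = ∞` are Laurent series in `t = 1 / z`. -/

/-- The function `z = t⁻¹`. -/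
def zInf : LaurentSeries ℂ := HahnSeries.single (-1) 1

/-- The derivation `d/dz = - t ^ 2 d/dt`. -/
def derivInf (f : LaurentSeries ℂ) : LaurentSeries ℂ :=
  -(HahnSeries.single 2 1 * LaurentSeries.derivative ℂ f)

/-- The formal series `∑_{m ≥ 0} c_m z^(-m-1)`. -/
def seriesInf (c : ℕ → ℂ) : LaurentSeries ℂ :=
  HahnSeries.single 1 1 * HahnSeries.ofPowerSeries ℤ ℂ (PowerSeries.mk c)

/-- The coefficients `c` are those of a formal solution `w = ∑_{m ≥ 0} c_m z^(-m-1)` of the `N`-th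
equation with parameter `α`. -/
def IsFormalSolution (N : ℕ) (α : ℂ) (c : ℕ → ℂ) : Prop :=
  painleveTwo derivInf zInf N α (seriesInf c) = 0

/-- The derivation `- t ^ 2 d/dt` on power series in `t`. -/
def psDeriv (f : PowerSeries ℂ) : PowerSeries ℂ :=
  -(PowerSeries.X ^ 2 * PowerSeries.derivative ℂ f)

theorem derivInf_ofPowerSeries (f : PowerSeries ℂ) :
    derivInf (HahnSeries.ofPowerSeries ℤ ℂ f) = HahnSeries.ofPowerSeries ℤ ℂ (psDeriv f) := by
  have h : LaurentSeries.derivative ℂ (HahnSeries.ofPowerSeries ℤ ℂ f)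
      = HahnSeries.ofPowerSeries ℤ ℂ (PowerSeries.derivative ℂ f) := by
    ext n
    rw [LaurentSeries.derivative_apply, LaurentSeries.hasseDeriv_coeff]
    rw [PowerSeries.coeff_coe, PowerSeries.coeff_coe, Ring.choose_one_right, Nat.cast_one]
    rcases lt_or_ge n 0 with hn | hn
    · rw [if_pos hn]
      rcases eq_or_ne (n + 1) 0 with h | h
      · rw [h, zero_smul]
      · rw [if_pos (by omega), smul_zero]
    · obtain ⟨k, rfl⟩ := Int.eq_ofNat_of_zero_le hn
      rw [if_neg (by omega), if_neg (by omega), PowerSeries.coeff_derivative,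
        show ((k : ℤ) + 1).natAbs = k + 1 by omega, Int.natAbs_natCast, zsmul_eq_mul, mul_comm]
      push_cast
      rfl
  rw [derivInf, psDeriv, h, map_neg, map_mul, HahnSeries.ofPowerSeries_X_pow]
  rfl

/-- The map whose fixed points are the coefficient series of the formal solutions. -/
def picard (N : ℕ) (α : ℂ) (c : PowerSeries ℂ) : PowerSeries ℂ :=
  let w : PowerSeries ℂ := PowerSeries.X * c
  let ℓ : PowerSeries ℂ :=
    MvPolynomial.aeval (fun j : ℕ => psDeriv^[j] (psDeriv w - w ^ 2)) (lenard N)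
  psDeriv ℓ + 2 * w * ℓ - PowerSeries.C α

theorem painleveTwo_seriesInf (N : ℕ) (α : ℂ) (c : ℕ → ℂ) :
    painleveTwo derivInf zInf N α (seriesInf c) =
      HahnSeries.ofPowerSeries ℤ ℂ (picard N α (PowerSeries.mk c) - PowerSeries.mk c) := by
  have hw : seriesInf c
      = HahnSeries.ofPowerSeries ℤ ℂ (PowerSeries.X * PowerSeries.mk c) := by
    rw [seriesInf, map_mul, HahnSeries.ofPowerSeries_X]
  have hz : zInf * seriesInf c = HahnSeries.ofPowerSeries ℤ ℂ (PowerSeries.mk c) := by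
    rw [zInf, seriesInf, ← mul_assoc, HahnSeries.single_mul_single]
    simp
  have hit : ∀ (j : ℕ) (f : PowerSeries ℂ), derivInf^[j] (HahnSeries.ofPowerSeries ℤ ℂ f)
      = HahnSeries.ofPowerSeries ℤ ℂ (psDeriv^[j] f) := by
    intro j
    induction j with
    | zero => intro f; rfl
    | succ j ih => intro f; rw [Function.iterate_succ_apply, Function.iterate_succ_apply,
        derivInf_ofPowerSeries, ih]
  have hα : ∀ r : ℂ, algebraMap ℂ (LaurentSeries ℂ) r
      = HahnSeries.ofPowerSeries ℤ ℂ (PowerSeries.C r) := by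
    intro r
    rw [HahnSeries.algebraMap_apply', PowerSeries.algebraMap_eq]
  have hae : ∀ (g : ℕ → PowerSeries ℂ) (P : DiffPoly),
      MvPolynomial.aeval (fun j => HahnSeries.ofPowerSeries ℤ ℂ (g j)) P
        = HahnSeries.ofPowerSeries ℤ ℂ (MvPolynomial.aeval g P) := by
    intro g P
    induction P using MvPolynomial.induction_on with
    | C a =>
      rw [MvPolynomial.aeval_C, MvPolynomial.aeval_C, hα, PowerSeries.algebraMap_eq]
    | add p q hp hq => simp only [map_add, hp, hq]
    | mul_X p n hp => simp only [map_mul, hp, MvPolynomial.aeval_X]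
  rw [painleveTwo, hz, hα, picard]
  simp only [hw, derivInf_ofPowerSeries, ← map_pow, ← map_sub, hit, hae]
  rw [show (2 : LaurentSeries ℂ) = HahnSeries.ofPowerSeries ℤ ℂ 2 from (map_ofNat _ 2).symm]
  simp only [← map_mul, ← map_add, ← map_sub]
  congr 1
  ring

theorem dvd_psDeriv_sub {k : ℕ} {f g : PowerSeries ℂ} (h : PowerSeries.X ^ k ∣ f - g) :
    PowerSeries.X ^ (k + 1) ∣ psDeriv f - psDeriv g := by
  obtain ⟨q, hq⟩ := h
  have h1 : psDeriv f - psDeriv g = psDeriv (PowerSeries.X ^ k * q) := by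
    rw [← hq, psDeriv, psDeriv, psDeriv, map_sub]; ring
  rw [h1, psDeriv, Derivation.leibniz, Derivation.leibniz_pow, PowerSeries.derivative_X, dvd_neg]
  cases k with
  | zero => exact Dvd.dvd.mul_right (pow_dvd_pow _ (by norm_num)) _
  | succ k =>
    refine ⟨PowerSeries.X * PowerSeries.derivative ℂ q + (k + 1 : ℕ) • q, ?_⟩
    simp only [smul_eq_mul, nsmul_eq_mul, Nat.add_sub_cancel]
    ring

theorem dvd_picard_sub (N : ℕ) (α : ℂ) {k : ℕ} {f g : PowerSeries ℂ}
    (h : PowerSeries.X ^ k ∣ f - g) :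
    PowerSeries.X ^ (k + 1) ∣ picard N α f - picard N α g := by
  have hw : PowerSeries.X ^ (k + 1) ∣ PowerSeries.X * f - PowerSeries.X * g := by
    rw [← mul_sub, pow_succ']; exact mul_dvd_mul_left _ h
  have hu : PowerSeries.X ^ (k + 1) ∣ (psDeriv (PowerSeries.X * f) - (PowerSeries.X * f) ^ 2)
      - (psDeriv (PowerSeries.X * g) - (PowerSeries.X * g) ^ 2) := by
    rw [sub_sub_sub_comm]
    exact dvd_sub ((pow_dvd_pow _ (Nat.le_succ _)).trans (dvd_psDeriv_sub hw))
      (hw.trans (sub_dvd_pow_sub_pow _ _ 2))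
  have hit : ∀ (j : ℕ) (a b : PowerSeries ℂ), PowerSeries.X ^ (k + 1) ∣ a - b →
      PowerSeries.X ^ (k + 1) ∣ psDeriv^[j] a - psDeriv^[j] b := by
    intro j
    induction j with
    | zero => intro a b hab; exact hab
    | succ j ih =>
      intro a b hab
      exact ih _ _ ((pow_dvd_pow _ (Nat.le_succ _)).trans (dvd_psDeriv_sub hab))
  have hae : ∀ (a b : ℕ → PowerSeries ℂ), (∀ j, PowerSeries.X ^ (k + 1) ∣ a j - b j) →
      ∀ P : DiffPoly, PowerSeries.X ^ (k + 1) ∣ MvPolynomial.aeval a P - MvPolynomial.aeval b P := by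
    intro a b hab P
    induction P using MvPolynomial.induction_on with
    | C r => simp
    | add p q hp hq =>
      rw [map_add, map_add, add_sub_add_comm]; exact dvd_add hp hq
    | mul_X p n hp =>
      rw [map_mul, map_mul, MvPolynomial.aeval_X, MvPolynomial.aeval_X]
      have e : MvPolynomial.aeval a p * a n - MvPolynomial.aeval b p * b n
          = (MvPolynomial.aeval a p - MvPolynomial.aeval b p) * a n
            + MvPolynomial.aeval b p * (a n - b n) := by ring
      rw [e]
      exact dvd_add (hp.mul_right _) ((hab n).mul_left _)
  have hl := hae _ _ (fun j => hit j _ _ hu) (lenard N)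
  simp only [picard]
  set a := MvPolynomial.aeval (fun j : ℕ =>
    psDeriv^[j] (psDeriv (PowerSeries.X * f) - (PowerSeries.X * f) ^ 2)) (lenard N)
  set b := MvPolynomial.aeval (fun j : ℕ =>
    psDeriv^[j] (psDeriv (PowerSeries.X * g) - (PowerSeries.X * g) ^ 2)) (lenard N)
  have hd := (pow_dvd_pow _ (Nat.le_succ (k + 1))).trans (dvd_psDeriv_sub hl)
  have e : psDeriv a + 2 * (PowerSeries.X * f) * a - PowerSeries.C α
      - (psDeriv b + 2 * (PowerSeries.X * g) * b - PowerSeries.C α)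
      = (psDeriv a - psDeriv b) + (2 * (PowerSeries.X * f) * (a - b)
        + 2 * b * (PowerSeries.X * f - PowerSeries.X * g)) := by ring
  rw [e]
  exact dvd_add hd (dvd_add (hl.mul_left _) (hw.mul_left _))

/-- There is exactly one formal solution at infinity for every value of the parameter. -/
theorem existsUnique_isFormalSolution (N : ℕ) (α : ℂ) : ∃! c, IsFormalSolution N α c := by
  have hiff : ∀ c, IsFormalSolution N α c ↔ picard N α (PowerSeries.mk c) = PowerSeries.mk c := by
    intro c
    rw [IsFormalSolution, painleveTwo_seriesInf,
      map_eq_zero_iff _ HahnSeries.ofPowerSeries_injective, sub_eq_zero]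
  have hext : ∀ f g : PowerSeries ℂ, (∀ k, PowerSeries.X ^ k ∣ f - g) → f = g := by
    intro f g h
    ext n
    have := (PowerSeries.X_pow_dvd_iff.mp (h (n + 1))) n (Nat.lt_succ_self n)
    rwa [map_sub, sub_eq_zero] at this
  let W : ℕ → PowerSeries ℂ := fun k => (picard N α)^[k] 0
  have hW : ∀ k, W (k + 1) = picard N α (W k) := fun k => Function.iterate_succ_apply' _ _ _
  have hstep : ∀ k, PowerSeries.X ^ k ∣ W (k + 1) - W k := by
    intro k
    induction k with
    | zero => simp
    | succ k ih => rw [hW (k + 1), hW k]; rw [hW k] at ih; exact dvd_picard_sub N α ih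
  have hfar : ∀ k j, PowerSeries.X ^ k ∣ W (k + j) - W k := by
    intro k j
    induction j with
    | zero => simp
    | succ j ih =>
      have := dvd_add ((pow_dvd_pow _ (Nat.le_add_right k j)).trans (hstep (k + j))) ih
      rwa [sub_add_sub_cancel] at this
  let c : ℕ → ℂ := fun m => PowerSeries.coeff m (W (m + 1))
  have hc : ∀ k, PowerSeries.X ^ k ∣ PowerSeries.mk c - W k := by
    intro k
    rw [PowerSeries.X_pow_dvd_iff]
    intro m hm
    obtain ⟨j, rfl⟩ := Nat.exists_eq_add_of_lt hm
    have := (PowerSeries.X_pow_dvd_iff.mp (hfar (m + 1) j)) m (Nat.lt_succ_self m)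
    rw [map_sub, sub_eq_zero] at this
    rw [map_sub, PowerSeries.coeff_mk, sub_eq_zero, show m + j + 1 = m + 1 + j by ring, this]
  have hcs : picard N α (PowerSeries.mk c) = PowerSeries.mk c := by
    refine hext _ _ fun k => ?_
    have h1 := (pow_dvd_pow _ (Nat.le_succ k)).trans (dvd_picard_sub N α (hc k))
    rw [← hW] at h1
    have h2 := (pow_dvd_pow _ (Nat.le_succ k)).trans (hc (k + 1))
    have := dvd_sub h1 h2
    rwa [sub_sub_sub_cancel_right] at this
  refine ⟨c, (hiff c).mpr hcs, fun b hb => ?_⟩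
  have hb' : picard N α (PowerSeries.mk b) = PowerSeries.mk b := (hiff b).mp hb
  have heq : PowerSeries.mk b = PowerSeries.mk c := by
    refine hext _ _ fun k => ?_
    induction k with
    | zero => simp
    | succ k ih => rw [← hb', ← hcs]; exact dvd_picard_sub N α ih
  funext m
  simpa using congrArg (PowerSeries.coeff m) heq

/-- `expansionCoeff N α m` is the coefficient of `z^(-m-1)` in the expansion at infinity of the
formal solution of the `N`-th equation with parameter `α`. By uniqueness this is the expansion
`w = -α / z + ∑_{l ≥ 1} c_((2 N + 1) l) z^(-(2 N + 1) l - 1)`. -/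
def expansionCoeff (N : ℕ) (α : ℂ) : ℕ → ℂ := (existsUnique_isFormalSolution N α).choose

theorem isFormalSolution_expansionCoeff (N : ℕ) (α : ℂ) :
    IsFormalSolution N α (expansionCoeff N α) := (existsUnique_isFormalSolution N α).choose_spec.1

end PIIHierarchy

end

noncomputable section

namespace PIIHierarchy

/-! ### The derivation at infinity -/

/-! For a monic polynomial `Q` with roots `a_k`, the geometric series gives `Q'/Q = ∑_k 1/(z - a_k)
= ∑_m s_m z^(-m-1)` at infinity, with `s_m` the power sums of the roots. So the expansion of `w =
(log (Q_{i-1}/Q_i))'` has coefficients `s_{i-1,m} - s_{i,m}` (`ratInf_logDerivQuot`).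

Expansion at infinity is an algebra homomorphism from rational functions to Laurent series in `1/z`
that commutes with `d/dz` (`ratInf_ratDeriv`), so it sends the rational solution to a formal
solution of the same equation (`map_painleveTwo`). The formal solution is unique, hence `s_{i-1,m} -
s_{i,m} = c_{i,-(m+1)}`, and summing over `i` telescopes down to `Q_0 = 1`, which has no roots.

The case `m = 0` counts the roots, which gives the degree. For `m ≥ 1` the term `i = 1` drops out,
because the formal solution for `α = 1` is exactly `-1/z` (`expansionCoeff_one`). -/

theorem coeff_derivInf (f : LaurentSeries ℂ) (n : ℤ) :
    (derivInf f).coeff n = -((n - 1 : ℤ) * f.coeff (n - 1)) := by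
  rw [derivInf, HahnSeries.coeff_neg, HahnSeries.coeff_single_mul, LaurentSeries.derivative_apply,
    LaurentSeries.hasseDeriv_coeff, Nat.cast_one, Ring.choose_one_right, zsmul_eq_mul, one_mul,
    show n - 2 + 1 = n - 1 by ring]

/-- Dividing `-t² d/dt` by `t` leaves the Euler operator `-t d/dt`, which multiplies the `n`-th
coefficient by `-n`. Its Leibniz rule is the identity `n = i + j` inside the convolution sum. -/
theorem derivInf_mul (f g : LaurentSeries ℂ) :
    derivInf (f * g) = f * derivInf g + g * derivInf f := by
  let θ : LaurentSeries ℂ → LaurentSeries ℂ := fun h =>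
    HahnSeries.single (-1) 1 * derivInf h
  have hθ : ∀ h n, (θ h).coeff n = -((n : ℂ) * h.coeff n) := by
    intro h n
    rw [HahnSeries.coeff_single_mul, coeff_derivInf, one_mul]
    simp
  -- Since `θ` does not enlarge supports, all three products can be summed over the same
  -- antidiagonal.
  have hsupp : ∀ h, (θ h).support ⊆ h.support := by
    intro h n hn hz
    exact hn (by rw [hθ, hz, mul_zero, neg_zero])
  have key : θ (f * g) = f * θ g + g * θ f := by
    rw [mul_comm g]
    ext n
    rw [hθ, HahnSeries.coeff_add, HahnSeries.coeff_mul,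
      HahnSeries.coeff_mul_left' f.isPWO_support (hsupp f),
      HahnSeries.coeff_mul_right' g.isPWO_support (hsupp g), ← Finset.sum_add_distrib,
      Finset.mul_sum, ← Finset.sum_neg_distrib]
    refine Finset.sum_congr rfl fun x hx => ?_
    rw [hθ, hθ, ← (Finset.mem_antidiagonal.mp hx).2.2]
    push_cast
    ring
  have hne : (HahnSeries.single (-1) 1 : LaurentSeries ℂ) ≠ 0 := by simp
  refine mul_left_cancel₀ hne ?_
  linear_combination key

theorem derivInf_add (f g : LaurentSeries ℂ) : derivInf (f + g) = derivInf f + derivInf g := by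
  ext n
  simp only [coeff_derivInf, HahnSeries.coeff_add]
  ring

theorem derivInf_zero : derivInf 0 = 0 := by
  rw [← add_eq_left (a := derivInf 0), ← derivInf_add, add_zero]

theorem derivInf_neg (f : LaurentSeries ℂ) : derivInf (-f) = -derivInf f := by
  rw [eq_neg_iff_add_eq_zero, ← derivInf_add, neg_add_cancel, derivInf_zero]

theorem derivInf_sub (f g : LaurentSeries ℂ) : derivInf (f - g) = derivInf f - derivInf g := by
  rw [sub_eq_add_neg, derivInf_add, derivInf_neg, sub_eq_add_neg]

theorem derivInf_one : derivInf 1 = 0 := by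
  have h := derivInf_mul 1 1
  rwa [mul_one, one_mul, left_eq_add] at h

theorem derivInf_pow (f : LaurentSeries ℂ) (n : ℕ) :
    derivInf (f ^ n) = n * f ^ (n - 1) * derivInf f := by
  induction n with
  | zero => simp [derivInf_one]
  | succ n ih =>
    rw [pow_succ, derivInf_mul, ih]
    cases n with
    | zero => simp
    | succ n => simp only [Nat.add_sub_cancel]; push_cast; ring

theorem derivInf_div (f : LaurentSeries ℂ) {g : LaurentSeries ℂ} (hg : g ≠ 0) :
    derivInf (f / g) = (derivInf f * g - f * derivInf g) / g ^ 2 := by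
  have h := derivInf_mul (f / g) g
  rw [div_mul_cancel₀ _ hg] at h
  rw [h]
  field_simp
  ring

theorem derivInf_zInf : derivInf zInf = 1 := by
  ext n
  rw [coeff_derivInf, zInf, HahnSeries.coeff_single, HahnSeries.coeff_one]
  rcases eq_or_ne n 0 with rfl | hn
  · simp
  · rw [if_neg (by omega), if_neg hn, mul_zero, neg_zero]

theorem derivInf_algebraMap (a : ℂ) :
    derivInf (algebraMap ℂ (LaurentSeries ℂ) a) = 0 := by
  rw [HahnSeries.algebraMap_apply', PowerSeries.algebraMap_eq, HahnSeries.ofPowerSeries_C]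
  ext n
  rw [coeff_derivInf, HahnSeries.C_apply, HahnSeries.coeff_single]
  split_ifs with h <;> simp [h]

theorem derivInf_aeval_zInf (p : ℂ[X]) :
    derivInf (aeval zInf p) = aeval zInf (derivative p) := by
  induction p using Polynomial.induction_on' with
  | add p q hp hq => simp only [map_add, derivInf_add, hp, hq]
  | monomial n a =>
    rw [derivative_monomial, aeval_monomial, aeval_monomial, derivInf_mul,
      derivInf_pow, derivInf_zInf, derivInf_algebraMap]
    simp only [map_mul, map_natCast]
    ring

/-! ### Expansion of rational functions at infinity -/

theorem seriesInf_eq (c : ℕ → ℂ) :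
    seriesInf c = HahnSeries.ofPowerSeries ℤ ℂ (PowerSeries.X * PowerSeries.mk c) := by
  rw [seriesInf, map_mul, HahnSeries.ofPowerSeries_X]

theorem zInf_mul_seriesInf (c : ℕ → ℂ) :
    zInf * seriesInf c = HahnSeries.ofPowerSeries ℤ ℂ (PowerSeries.mk c) := by
  rw [zInf, seriesInf, ← mul_assoc, HahnSeries.single_mul_single]
  simp

theorem seriesInf_add (b c : ℕ → ℂ) : seriesInf (b + c) = seriesInf b + seriesInf c := by
  rw [seriesInf_eq, seriesInf_eq, seriesInf_eq, ← map_add, ← mul_add]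
  congr 2

theorem seriesInf_sub (b c : ℕ → ℂ) : seriesInf (b - c) = seriesInf b - seriesInf c := by
  rw [eq_sub_iff_add_eq, ← seriesInf_add, sub_add_cancel]

theorem algebraMap_laurentSeries (a : ℂ) : algebraMap ℂ (LaurentSeries ℂ) a
    = HahnSeries.ofPowerSeries ℤ ℂ (PowerSeries.C a) := by
  rw [HahnSeries.algebraMap_apply', PowerSeries.algebraMap_eq]

/-- The expansion `1 / (z - a) = ∑ a ^ m z^(-m-1)`. -/
theorem zInf_sub_mul_seriesInf_pow (a : ℂ) :
    (zInf - algebraMap ℂ (LaurentSeries ℂ) a) * seriesInf (fun m => a ^ m) = 1 := by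
  rw [sub_mul, zInf_mul_seriesInf, algebraMap_laurentSeries, seriesInf_eq, ← map_mul, ← map_sub,
    ← map_one (HahnSeries.ofPowerSeries ℤ ℂ)]
  congr 1
  ext n
  cases n with
  | zero => simp
  | succ n => simp [PowerSeries.coeff_succ_X_mul, PowerSeries.coeff_one, pow_succ']

/-- Over `ℂ` the polynomial splits, and each factor `z - a` is invertible, with a geometric series
as inverse. -/
theorem aeval_zInf_ne_zero {p : ℂ[X]} (hp : p ≠ 0) : aeval zInf p ≠ 0 := by
  rw [(IsAlgClosed.splits p).eq_prod_roots, map_mul, aeval_C, map_multiset_prod]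
  refine mul_ne_zero ?_ (Multiset.prod_ne_zero fun h => ?_)
  · rw [_root_.map_ne_zero]
    exact leadingCoeff_ne_zero.mpr hp
  · simp only [Multiset.map_map, Multiset.mem_map, Function.comp_apply, map_sub, aeval_X,
      aeval_C] at h
    obtain ⟨a, -, ha⟩ := h
    have := zInf_sub_mul_seriesInf_pow a
    rw [ha, zero_mul] at this
    exact zero_ne_one this

/-- Logarithmic derivatives add over the factors, and `z - a` contributes the series of `1/(z - a)`.
The equation is kept free of denominators so that induction on the roots applies. -/
theorem derivInf_aeval_prod (s : Multiset ℂ) :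
    derivInf (aeval zInf (s.map fun a => X - C a).prod)
      = aeval zInf (s.map fun a => X - C a).prod
        * seriesInf (fun m => (s.map fun a => a ^ m).sum) := by
  induction s using Multiset.induction_on with
  | empty =>
    have h : seriesInf (fun _ => 0) = 0 := by
      rw [seriesInf_eq, show (PowerSeries.mk fun _ => (0 : ℂ)) = 0 from rfl, mul_zero, map_zero]
    simp [h, derivInf_one]
  | cons a s ih =>
    have h : seriesInf (fun m => ((a ::ₘ s).map fun a => a ^ m).sum)
        = seriesInf (fun m => a ^ m) + seriesInf (fun m => (s.map fun a => a ^ m).sum) := by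
      rw [← seriesInf_add]
      congr 1
      funext m
      simp
    have hX : derivInf (zInf - algebraMap ℂ (LaurentSeries ℂ) a) = 1 := by
      rw [derivInf_sub, derivInf_zInf, derivInf_algebraMap, sub_zero]
    rw [h, Multiset.map_cons, Multiset.prod_cons, map_mul, derivInf_mul, ih, map_sub, aeval_X,
      aeval_C, hX]
    linear_combination (-aeval zInf (s.map fun a => X - C a).prod) * zInf_sub_mul_seriesInf_pow a

/-- The logarithmic derivative of a monic polynomial is the generating series of the power sums
of its roots. -/
theorem derivInf_aeval_of_monic {Q : ℂ[X]} (hQ : Q.Monic) :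
    derivInf (aeval zInf Q) = aeval zInf Q * seriesInf (rootPowerSum Q) := by
  have h := derivInf_aeval_prod Q.roots
  rwa [← (IsAlgClosed.splits Q).eq_prod_roots_of_monic hQ] at h

/-- The expansion of rational functions at infinity. -/
def ratInf : RatFunc ℂ →ₐ[ℂ] LaurentSeries ℂ :=
  RatFunc.liftAlgHom (aeval zInf) fun _ hp =>
    mem_nonZeroDivisors_of_ne_zero (aeval_zInf_ne_zero (nonZeroDivisors.ne_zero hp))

theorem ratInf_algebraMap (p : ℂ[X]) :
    ratInf (algebraMap ℂ[X] (RatFunc ℂ) p) = aeval zInf p :=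
  RatFunc.liftRingHom_algebraMap _ _ p

theorem ratInf_X : ratInf RatFunc.X = zInf := by
  rw [← RatFunc.algebraMap_X, ratInf_algebraMap, aeval_X]

/-- `ratDeriv` is the quotient rule on the reduced fraction, so it suffices to apply the quotient
rule for Laurent series to that same fraction; no derivation property of `ratDeriv` is needed. -/
theorem ratInf_ratDeriv (f : RatFunc ℂ) : ratInf (ratDeriv f) = derivInf (ratInf f) := by
  have hd := aeval_zInf_ne_zero f.denom_ne_zero
  conv_rhs => rw [← RatFunc.num_div_denom f, map_div₀, ratInf_algebraMap, ratInf_algebraMap,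
    derivInf_div _ hd, derivInf_aeval_zInf, derivInf_aeval_zInf]
  simp only [ratDeriv, map_div₀, map_sub, map_mul, map_pow, ratInf_algebraMap]

theorem ratInf_logDerivQuot {P Q : ℂ[X]} (hP : P.Monic) (hQ : Q.Monic) :
    ratInf (logDerivQuot P Q) = seriesInf (rootPowerSum P - rootPowerSum Q) := by
  have hp := aeval_zInf_ne_zero hP.ne_zero
  have hq := aeval_zInf_ne_zero hQ.ne_zero
  rw [logDerivQuot, map_div₀, ratInf_ratDeriv, map_div₀, ratInf_algebraMap, ratInf_algebraMap,
    derivInf_div _ hq, derivInf_aeval_of_monic hP, derivInf_aeval_of_monic hQ, seriesInf_sub]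
  field_simp

/-- The left-hand side of the hierarchy is natural in the differential algebra. -/
theorem map_painleveTwo {A B : Type*} [CommRing A] [Algebra ℂ A] [CommRing B] [Algebra ℂ B]
    (φ : A →ₐ[ℂ] B) {d : A → A} {e : B → B} (h : ∀ a, φ (d a) = e (φ a)) (z : A) (N : ℕ) (α : ℂ)
    (w : A) : φ (painleveTwo d z N α w) = painleveTwo e (φ z) N α (φ w) := by
  have hit : ∀ (j : ℕ) (a : A), φ (d^[j] a) = e^[j] (φ a) := fun j =>
    (Function.Semiconj.iterate_right (f := φ) h j)
  have hae : ∀ g : ℕ → A, φ (MvPolynomial.aeval g (lenard N))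
      = MvPolynomial.aeval (fun j => φ (g j)) (lenard N) := fun g =>
    MvPolynomial.map_aeval g φ.toRingHom (lenard N) |>.trans (by
      rw [MvPolynomial.aeval_def, ← φ.comp_algebraMap]; rfl)
  simp only [painleveTwo, map_sub, map_add, map_mul, h, hae, hit, map_pow, AlgHom.commutes,
    map_ofNat]

/-! ### Formal solutions -/

theorem IsFormalSolution.eq_expansionCoeff {N : ℕ} {α : ℂ} {c : ℕ → ℂ}
    (hc : IsFormalSolution N α c) : c = expansionCoeff N α :=
  (existsUnique_isFormalSolution N α).unique hc (isFormalSolution_expansionCoeff N α)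

/-- For `α = 1` the formal solution is `-1 / z`. -/
theorem expansionCoeff_one {N : ℕ} (hN : 1 ≤ N) {m : ℕ} (hm : 1 ≤ m) :
    expansionCoeff N 1 m = 0 := by
  have hz : zInf * seriesInf (fun m => if m = 0 then 1 else 0) = 1 := by
    rw [zInf_mul_seriesInf, ← map_one (HahnSeries.ofPowerSeries ℤ ℂ)]
    congr 1
    ext n
    simp [PowerSeries.coeff_one]
  have hz0 : zInf ≠ 0 := left_ne_zero_of_mul_eq_one hz
  have hw : seriesInf (fun m => if m = 0 then -1 else 0) = -zInf⁻¹ := by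
    have h : seriesInf (fun m => if m = 0 then -1 else 0)
        + seriesInf (fun m => if m = 0 then 1 else 0) = 0 := by
      rw [← seriesInf_add, seriesInf_eq, map_eq_zero_iff _ HahnSeries.ofPowerSeries_injective]
      ext n
      cases n <;> simp [PowerSeries.coeff_succ_X_mul]
      split_ifs <;> simp
    rw [eq_neg_of_add_eq_zero_left h, eq_inv_of_mul_eq_one_right hz]
  have hd : derivInf (-zInf⁻¹) = zInf⁻¹ ^ 2 := by
    rw [derivInf_neg, inv_eq_one_div, derivInf_div _ hz0, derivInf_one, derivInf_zInf]
    ring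
  have hit : ∀ j, derivInf^[j] 0 = 0 := fun j =>
    Function.iterate_fixed derivInf_zero j
  -- This is where `N ≥ 1` enters: `L_N` then has no constant term, whereas `L_0 = 1/2` does not
  -- vanish at `u = 0`.
  have hl : MvPolynomial.aeval (fun _ => (0 : LaurentSeries ℂ)) (lenard N) = 0 := by
    obtain ⟨k, rfl⟩ := Nat.exists_eq_add_of_le' hN
    rw [MvPolynomial.aeval_zero', isLenardSequence_lenard.constantCoeff, map_zero]
  have hsol : IsFormalSolution N 1 (fun m => if m = 0 then -1 else 0) := by
    rw [IsFormalSolution, hw, painleveTwo]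
    -- For `w = -1/z` the argument `w' - w²` vanishes, so the equation reduces to `-z w - 1 = 0`.
    have hu : zInf⁻¹ ^ 2 - (-zInf⁻¹) ^ 2 = 0 := by ring
    simp only [hd, hu, hit, hl]
    rw [derivInf_zero, map_one]
    field_simp
    ring
  rw [← hsol.eq_expansionCoeff]
  exact if_neg (by omega)

/-! ### Power sums of the roots of the Yablonskii–Vorob'ev polynomials -/

theorem IsYablonskiiVorobev.monic {N n : ℕ} {Q : ℂ[X]} (hQ : IsYablonskiiVorobev N n Q) :
    Q.Monic := by
  cases hQ with
  | zero => exact monic_one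
  | succ _ hQ _ => exact hQ

/-- Both sides are coefficient sequences of formal solutions for the same parameter, so uniqueness
identifies them. -/
theorem rootPowerSum_sub_of_painleveTwo {N : ℕ} {α : ℂ} {P Q : ℂ[X]} (hP : P.Monic) (hQ : Q.Monic)
    (hw : painleveTwo ratDeriv RatFunc.X N α (logDerivQuot P Q) = 0) :
    rootPowerSum P - rootPowerSum Q = expansionCoeff N α := by
  refine IsFormalSolution.eq_expansionCoeff ?_
  rw [IsFormalSolution, ← ratInf_logDerivQuot hP hQ, ← ratInf_X,
    ← map_painleveTwo ratInf ratInf_ratDeriv, hw, map_zero]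

theorem IsYablonskiiVorobev.rootPowerSum_eq {N n : ℕ} {Q : ℂ[X]} (hQ : IsYablonskiiVorobev N n Q)
    (m : ℕ) : rootPowerSum Q m = -∑ i ∈ Finset.Icc 1 n, expansionCoeff N (i : ℂ) m := by
  induction hQ with
  | zero => simp [rootPowerSum]
  | @succ n P Q hP hQ hw ih =>
    have h := congrFun (rootPowerSum_sub_of_painleveTwo hP.monic hQ hw) m
    rw [Pi.sub_apply] at h
    rw [Finset.sum_Icc_succ_top (by omega), Nat.cast_succ]
    linear_combination ih - h

/-- Every root contributes `a ^ 0 = 1`, including `a = 0`, and over `ℂ` the number of roots is the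
degree. -/
theorem rootPowerSum_zero (Q : ℂ[X]) : rootPowerSum Q 0 = Q.natDegree := by
  simp [rootPowerSum, (IsAlgClosed.splits Q).natDegree_eq_card_roots]

end PIIHierarchy

end

theorem theorem2 (N n : ℕ) (hN : 1 ≤ N) (hn : 2 ≤ n) (Q : ℂ[X])
    (hQ : PIIHierarchy.IsYablonskiiVorobev N n Q) :
    (∀ m : ℕ, 1 ≤ m → PIIHierarchy.rootPowerSum Q m =
      -∑ i ∈ Finset.Icc 2 n, PIIHierarchy.expansionCoeff N (i : ℂ) m) ∧
    (Q.natDegree : ℂ) = -∑ i ∈ Finset.Icc 1 n, PIIHierarchy.expansionCoeff N (i : ℂ) 0 := by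
  refine ⟨fun m hm => ?_, ?_⟩
  -- Splitting off `i = 1` leaves a sum over `Ioc 1 n`, which for naturals is `Icc 2 n` by
  -- definition.
  · rw [hQ.rootPowerSum_eq, ← Finset.add_sum_Ioc_eq_sum_Icc (by omega), Nat.cast_one,
      PIIHierarchy.expansionCoeff_one hN hm, zero_add]
    rfl
  · rw [← PIIHierarchy.rootPowerSum_zero, hQ.rootPowerSum_eq]
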